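/- A hyperfield is a set $F$ with a commutative multiplication and a multivalued commutative, associative addition $\boxplus$ (with values nonempty subsets of $F$) such that: $0\boxplus x=\{x\}$; each $x$ has a unique $-x$ with $0\in x\boxplus(-x)$; $x\in y\boxplus z$ iff $z\in x\boxplus(-y)$; $a(x\boxplus y)=ax\boxplus ay$; $0\cdot x=0$; $1\ne0$; and $F^\times:=F\setminus\{0\}$ is a group under multiplication with identity $1$. Let $F$ be a hyperfield with an involution $x\mapsto\bar x$ (a map with $\overline{xy}=\bar x\bar y$, $\bar 1=1$, $\bar 0=0$, $\overline{x\boxplus y}=\bar x\boxplus\bar y$, $\bar{\bar x}=x$; the identity is allowed), and let $E$ be a finite set. For $X\in F^E$ let $\underline X=\{e\in E: X(e)\ne0\}$ be its support. For $X,Y\in F^E$ write $X\perp Y$ if $0$ lies in the hypersum of the elements $X(e)\overline{Y(e)}$, $e\in E$ (the empty hypersum being $\{0\}$). For $S\subseteq F^E$ let $S^\perp=\{X\in F^E : X\perp Y\text{ for all }Y\in S\}$. A strong $F$-matroid $N$ on $E$ is given by its set of $F$-circuits, a set $\mathcal C\subseteq F^E$ such that: (C0) $0\notin\mathcal C$.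 (C1) $\alpha X\in\mathcal C$ for all $X\in\mathcal C$, $\alpha\in F^\times$. (C2) If $X,Y\in\mathcal C$ and $\underline X\subseteq\underline Y$, then $X=\alpha Y$ for some $\alpha\in F^\times$. (C3) Let $X,X_1,\dots,X_k\in\mathcal C$ be such that the height of $\underline X\cup\bigcup_i\underline{X_i}$ in the lattice of all unions of supports of elements of $\mathcal C$ (ordered by inclusion, with least element $\emptyset$) is $k+1$, and such that $\underline X\not\subseteq\bigcup_i\underline{X_i}$. For $1\le i\le k$ let $e_i\in(\underline X\cap\underline{X_i})\setminus\bigcup_{j\ne i}\underline{X_j}$ be such that $X(e_i)=-X_i(e_i)\neq0$. Then there is $Z\in\mathcal C$ with $Z(e_i)=0$ for $1\le i\le k$ and $Z(f)\in X(f)\boxplus X_1(f)\boxplus\cdots\boxplus X_k(f)$ for all $f\in E$. The underlying matroid of $N$ is the matroid on $E$ whose circuits are the supports of the $F$-circuits of $N$. The $F$-cocircuits of $N$ (the $F$-circuits of its dual) are the elements of minimal support of $\mathcal C^\perp\setminus\{0\}$. An $F$-signature of a matroid $M$ on $E$ is a set $\mathcal C\subseteq F^E$ satisfying (C0) and (C1)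 such that taking supports gives a bijection from the set of classes of elements of $\mathcal C$ modulo $F^\times$ to the set of circuits of $M$. **Theorem.** Let $M$ be a matroid on $E$ with dual matroid $M^*$, let $\mathcal C$ be an $F$-signature of $M$, and let $\mathcal D$ be an $F$-signature of $M^*$. Then $\mathcal C$ and $\mathcal D$ are the set of $F$-circuits and the set of $F$-cocircuits, respectively, of a strong $F$-matroid with underlying matroid $M$ if and only if $X\perp Y$ for all $X\in\mathcal C$ and $Y\in\mathcal D$. -/

import Mathlib

/-- A commutative (canonical) hypergroup: a set with a commutative and associative operation
`hadd` whose values are nonempty subsets, a neutral element, unique hyperinverses, and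
reversibility. -/
class CommHypergroup (G : Type*) extends Zero G, Neg G where
  /-- The hyperaddition `x ⊞ y`. -/
  hadd : G → G → Set G
  hadd_nonempty : ∀ x y, (hadd x y).Nonempty
  hadd_comm : ∀ x y, hadd x y = hadd y x
  hadd_assoc : ∀ x y z, (⋃ u ∈ hadd y z, hadd x u) = ⋃ u ∈ hadd x y, hadd u z
  zero_hadd : ∀ x, hadd 0 x = {x}
  zero_mem_hadd_neg : ∀ x, (0 : G) ∈ hadd x (-x)
  eq_neg_of_zero_mem : ∀ x y, (0 : G) ∈ hadd x y → y = -x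
  mem_hadd_iff : ∀ x y z, x ∈ hadd y z ↔ z ∈ hadd x (-y)

/-- A commutative hyperring. -/
class Hyperring (R : Type*) extends CommHypergroup R, CommMonoidWithZero R where
  mul_hadd : ∀ a x y : R, (fun u => a * u) '' hadd x y = hadd (a * x) (a * y)

/-- A hyperfield: a hyperring with `0 ≠ 1` in which every nonzero element is invertible
(as usual in Mathlib, the inverse of `0` is set to `0`). -/
class Hyperfield (F : Type*) extends Hyperring F, CommGroupWithZero F

namespace HyperMatroid

section Sums

variable {G : Type*} [CommHypergroup G]

/-- Subsets of a hypergroup, considered with the setwise hyperaddition. -/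
def Subsets (G : Type*) : Type _ := Set G

/-- The setwise hypersum `A ⊞ B`, the union of all `a ⊞ b` with `a ∈ A`, `b ∈ B`. -/
def setAdd (A B : Set G) : Set G := ⋃ a ∈ A, ⋃ b ∈ B, CommHypergroup.hadd a b

theorem mem_setAdd {A B : Set G} {x : G} :
    x ∈ setAdd A B ↔ ∃ a ∈ A, ∃ b ∈ B, x ∈ CommHypergroup.hadd a b := by
  simp [setAdd]

theorem setAdd_comm (A B : Set G) : setAdd A B = setAdd B A := by
  ext x
  simp only [mem_setAdd]
  constructor
  · rintro ⟨a, ha, b, hb, h⟩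
    exact ⟨b, hb, a, ha, by rwa [CommHypergroup.hadd_comm]⟩
  · rintro ⟨a, ha, b, hb, h⟩
    exact ⟨b, hb, a, ha, by rwa [CommHypergroup.hadd_comm]⟩

theorem zero_setAdd (A : Set G) : setAdd {0} A = A := by
  ext x
  simp [mem_setAdd, CommHypergroup.zero_hadd]

theorem setAdd_assoc (A B C : Set G) : setAdd (setAdd A B) C = setAdd A (setAdd B C) := by
  ext x
  simp only [mem_setAdd]
  constructor
  · rintro ⟨u, ⟨a, ha, b, hb, hu⟩, c, hc, hx⟩
    have h : x ∈ ⋃ u ∈ CommHypergroup.hadd a b, CommHypergroup.hadd u c := by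
      simpa using ⟨u, hu, hx⟩
    rw [← CommHypergroup.hadd_assoc] at h
    obtain ⟨v, hv, hxv⟩ : ∃ v ∈ CommHypergroup.hadd b c, x ∈ CommHypergroup.hadd a v := by
      simpa using h
    exact ⟨a, ha, v, ⟨b, hb, c, hc, hv⟩, hxv⟩
  · rintro ⟨a, ha, v, ⟨b, hb, c, hc, hv⟩, hx⟩
    have h : x ∈ ⋃ v ∈ CommHypergroup.hadd b c, CommHypergroup.hadd a v := by
      simpa using ⟨v, hv, hx⟩
    rw [CommHypergroup.hadd_assoc] at h
    obtain ⟨u, hu, hxu⟩ : ∃ u ∈ CommHypergroup.hadd a b, x ∈ CommHypergroup.hadd u c := by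
      simpa using h
    exact ⟨u, ⟨a, ha, b, hb, hu⟩, c, hc, hxu⟩

instance : Zero (Subsets G) := ⟨({0} : Set G)⟩

instance : Add (Subsets G) := ⟨fun A B => setAdd (G := G) A B⟩

instance : AddCommMonoid (Subsets G) where
  add_assoc := setAdd_assoc (G := G)
  zero_add := zero_setAdd (G := G)
  add_zero A := (setAdd_comm (G := G) A {0}).trans (zero_setAdd (G := G) A)
  add_comm := setAdd_comm (G := G)
  nsmul := nsmulRec

/-- A one-element subset. -/
def single (x : G) : Subsets G := ({x} : Set G)

/-- The hypersum `⊞ i, x i` of a finite family: the sum of the one-element subsets `{x i}` for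
the setwise hyperaddition. The hypersum of the empty family is `{0}`. -/
def hyperSum {ι : Type*} [Fintype ι] (x : ι → G) : Set G :=
  (∑ i, single (x i) : Subsets G)

end Sums

section Circuits

variable {F : Type*} [Hyperfield F] {E : Type*}

/-- An involution of a hyperfield: a map preserving multiplication, `1`, `0` and hyperaddition,
whose square is the identity. -/
structure Involution (F : Type*) [Hyperfield F] extends F →*₀ F where
  map_hadd : ∀ x y : F, toFun '' CommHypergroup.hadd x y = CommHypergroup.hadd (toFun x) (toFun y)
  involutive : ∀ x, toFun (toFun x) = x

/-- Orthogonality `X ⊥ Y`: `0` lies in the hypersum of the `X e * τ (Y e)`. -/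
def Orthogonal [Fintype E] (τ : Involution F) (X Y : E → F) : Prop :=
  (0 : F) ∈ hyperSum (fun e => X e * τ.toFun (Y e))

/-- The set of all vectors orthogonal to every element of `S`. -/
def perp [Fintype E] (τ : Involution F) (S : Set (E → F)) : Set (E → F) :=
  {X | ∀ Y ∈ S, Orthogonal τ X Y}

/-- The elements of `S` of (inclusion-)minimal support. -/
def suppMin (S : Set (E → F)) : Set (E → F) :=
  {X | X ∈ S ∧ ∀ Y ∈ S, Function.support Y ⊆ Function.support X →
    Function.support Y = Function.support X}

/-- Projective equivalence of vectors: equality up to a nonzero scalar. -/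
def projSetoid (F E : Type*) [Hyperfield F] : Setoid (E → F) where
  r X Y := ∃ a : F, a ≠ 0 ∧ X = a • Y
  iseqv := by
    refine ⟨fun X => ⟨1, one_ne_zero, by simp⟩, ?_, ?_⟩
    · rintro X Y ⟨a, ha, rfl⟩
      exact ⟨a⁻¹, inv_ne_zero ha, by rw [smul_smul, inv_mul_cancel₀ ha, one_smul]⟩
    · rintro X Y Z ⟨a, ha, rfl⟩ ⟨b, hb, rfl⟩
      exact ⟨a * b, mul_ne_zero ha hb, by rw [smul_smul]⟩

/-- The support of a projective equivalence class of vectors. -/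
def projSupport (F E : Type*) [Hyperfield F] : Quotient (projSetoid F E) → Set E :=
  Quotient.lift (fun X : E → F => Function.support X) (by
    rintro X Y ⟨a, ha, rfl⟩
    ext e
    simp [ha])

/-- `C` is an `F`-signature of the matroid `M`: it does not contain `0`, it is stable under
multiplication by nonzero scalars, and taking supports gives a bijection from the
projectivization of `C` to the set of circuits of `M`. -/
structure IsSignature (M : Matroid E) (C : Set (E → F)) : Prop where
  zero_notMem : (0 : E → F) ∉ C
  smul_mem : ∀ X ∈ C, ∀ a : F, a ≠ 0 → a • X ∈ C
  bijOn : Set.BijOn (projSupport F E) (Quotient.mk (projSetoid F E) '' C) {S | M.IsCircuit S}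

/-- The family `U(𝒮)` of all unions of subfamilies of `𝒮`, ordered by inclusion. -/
def unionLattice (𝒮 : Set (Set E)) : Set (Set E) := {A | ∃ T ⊆ 𝒮, A = ⋃₀ T}

/-- A finite family of members of `𝒮` is modular if the height of its join (that is, its union)
in `U(𝒮)` is the size of the family. -/
def IsModularFamily (𝒮 : Set (Set E)) {n : ℕ} (A : Fin n → Set E) : Prop :=
  (∀ i, A i ∈ 𝒮) ∧
    ∃ h : (⋃ i, A i) ∈ unionLattice 𝒮, Order.height (⟨⋃ i, A i, h⟩ : unionLattice 𝒮) = n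

/-- Strong modular elimination. -/
def StrongModularElimination (C : Set (E → F)) : Prop :=
  ∀ (k : ℕ) (X : E → F) (Y : Fin k → E → F) (e : Fin k → E),
    X ∈ C → (∀ i, Y i ∈ C) →
    IsModularFamily (Function.support '' C)
      (Fin.cons (Function.support X) fun i => Function.support (Y i)) →
    ¬ Function.support X ⊆ ⋃ i, Function.support (Y i) →
    (∀ i, e i ∈ (Function.support X ∩ Function.support (Y i)) \
      ⋃ j ∈ {j | j ≠ i}, Function.support (Y j)) →
    (∀ i, X (e i) = -(Y i (e i)) ∧ X (e i) ≠ 0) →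
    ∃ Z ∈ C, (∀ i, Z (e i) = 0) ∧
      ∀ f, Z f ∈ setAdd {X f} (hyperSum fun i => Y i f)

/-- A strong `F`-matroid on `E`, given by its set of `F`-circuits. -/
structure StrongFMatroid (F E : Type*) [Hyperfield F] where
  /-- The set of `F`-circuits. -/
  circuits : Set (E → F)
  zero_notMem : (0 : E → F) ∉ circuits
  smul_mem : ∀ X ∈ circuits, ∀ a : F, a ≠ 0 → a • X ∈ circuits
  incomparable : ∀ X ∈ circuits, ∀ Y ∈ circuits,
    Function.support X ⊆ Function.support Y → ∃ a : F, a ≠ 0 ∧ X = a • Y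
  strong_elimination : StrongModularElimination circuits

/-- `M` is the underlying matroid of `N`: its ground set is all of `E` and its circuits are the
supports of the `F`-circuits of `N`. -/
def StrongFMatroid.IsUnderlying (N : StrongFMatroid F E) (M : Matroid E) : Prop :=
  M.E = Set.univ ∧ ∀ S : Set E, M.IsCircuit S ↔ S ∈ Function.support '' N.circuits

/-- The `F`-cocircuits of `N`, i.e. the `F`-circuits of the dual of `N`: the nonzero vectors of
minimal support in the orthogonal complement of the set of `F`-circuits. -/
def StrongFMatroid.cocircuits [Fintype E] (N : StrongFMatroid F E) (τ : Involution F) :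
    Set (E → F) :=
  suppMin (perp τ N.circuits \ {0})

end Circuits

end HyperMatroid

/-! The forward direction is immediate: cocircuits lie in the orthogonal complement of the circuits,
and orthogonality is symmetric. For the converse, minimality comes from matroid duality. The support
of a nonzero `W` orthogonal to `C` never meets a circuit in one element, so it contains a cocircuit.
Circuits meeting a cocircuit in exactly two elements fix all ratios of entries, so `W` is determined
up to scaling by its support (`exists_smul_eq_of_orthogonal`, `suppMin_perp_eq`). For elimination,
pick `f₀` in the support of `X` outside those of the `Y i`, and let `B` consist of `f₀` and the `e
i`. A circuit vector `Z` through `f₀` avoiding the `e i` is scaled to agree with `X` at `f₀`. For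
each other `f`, modularity yields a cocircuit vector `V` that meets the union of the supports only
inside `B ∪ {f}` (`exists_isCocircuit_of_height_lt`). Orthogonality of `V` to `Z` and to each `Y i`
involves only two terms; substituting these into `X ⊥ V` and cancelling `V f` gives the elimination
relation at `f`. -/

namespace Matroid

/-! ### Circuits against cocircuits in a matroid -/

variable {α : Type*} {M : Matroid α}

theorem exists_isCocircuit_disjoint {S : Set α} {f : α} (hS : S ⊆ M.E) (hf : f ∈ M.E)
    (hfS : f ∉ M.closure S) : ∃ K, M.IsCocircuit K ∧ f ∈ K ∧ Disjoint K S := by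
  obtain ⟨I, hI⟩ := M.exists_isBasis S
  have hfI : f ∉ M.closure I := by rwa [hI.closure_eq_closure]
  have hind : M.Indep (insert f I) := by
    rw [hI.indep.insert_indep_iff]
    exact Or.inl ⟨hf, hfI⟩
  obtain ⟨K, hK, hKI⟩ := hind.exists_isCocircuit_inter_eq_mem (Set.mem_insert f I)
  have hfK : f ∈ K := (hKI.symm.subset rfl).1
  refine ⟨K, hK, hfK, Set.disjoint_left.2 fun s hsK hsS => ?_⟩
  have hKI' : ∀ x ∈ K, x ∉ I := fun x hxK hxI => by
    obtain rfl : x = f := hKI.subset ⟨hxK, Set.mem_insert_of_mem _ hxI⟩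
    exact hfI (M.mem_closure_of_mem hxI hI.indep.subset_ground)
  -- A point `s` of `K ∩ S` would lie on a circuit inside `insert s I`, which meets `K` only in `s`.
  obtain ⟨A, hAI, hA, hsA⟩ := exists_isCircuit_of_mem_closure (hI.subset_closure hsS)
    (hKI' s hsK)
  refine hA.inter_isCocircuit_ne_singleton hK (e := s) ?_
  ext x
  constructor
  · rintro ⟨hxA, hxK⟩
    exact (hAI hxA).resolve_right (hKI' x hxK)
  · rintro rfl
    exact ⟨hsA, hsK⟩

/-- `K \ {f}` is coindependent, so some circuit meets it only in `e`; that circuit must contain `f`,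
since it cannot meet `K` in one element. -/
theorem IsCocircuit.exists_isCircuit_inter_eq_pair {K : Set α} (hK : M.IsCocircuit K) {e f : α}
    (he : e ∈ K) (hf : f ∈ K) (hef : e ≠ f) : ∃ A, M.IsCircuit A ∧ A ∩ K = {e, f} := by
  obtain ⟨A, hA, hAK⟩ := (hK.isCircuit.sdiff_singleton_indep hf).exists_isCocircuit_inter_eq_mem
    (e := e) ⟨he, hef⟩
  rw [dual_isCocircuit_iff] at hA
  have heA : e ∈ A := (hAK.symm.subset rfl).1
  have hsub : ∀ x ∈ A, x ∈ K → x ≠ f → x = e := fun x hxA hxK hxf => hAK.subset ⟨hxA, hxK, hxf⟩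
  have hfA : f ∈ A := by
    by_contra hfA
    refine hA.inter_isCocircuit_ne_singleton hK (e := e) ?_
    ext x
    constructor
    · rintro ⟨hxA, hxK⟩
      exact hsub x hxA hxK (by rintro rfl; exact hfA hxA)
    · rintro rfl
      exact ⟨heA, he⟩
  refine ⟨A, hA, ?_⟩
  ext x
  constructor
  · rintro ⟨hxA, hxK⟩
    by_cases hxf : x = f
    · exact Or.inr hxf
    · exact Or.inl (hsub x hxA hxK hxf)
  · rintro (rfl | rfl)
    exacts [⟨heA, he⟩, ⟨hfA, hf⟩]

/-- If `W` were coindependent, each of its elements would be the only one that some circuit shares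
with `W`. -/
theorem exists_isCocircuit_subset {W : Set α} (hW : W.Nonempty) (hWE : W ⊆ M.E)
    (h : ∀ A, M.IsCircuit A → ∀ e, A ∩ W ≠ {e}) : ∃ K ⊆ W, M.IsCocircuit K := by
  have hdep : M✶.Dep W := by
    rw [← not_indep_iff (by simpa using hWE)]
    intro hind
    obtain ⟨e, he⟩ := hW
    obtain ⟨A, hA, hAW⟩ := hind.exists_isCocircuit_inter_eq_mem he
    exact h A (dual_isCocircuit_iff.1 hA) e hAW
  exact hdep.exists_isCircuit_subset

end Matroid

namespace HyperMatroid

/-! ### Lower bounds for heights in the lattice of unions -/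

section Height

variable {E : Type*}

/-- The union of all members of `𝒮` contained in `S`, as an element of the union lattice. -/
def unionBelow (𝒮 : Set (Set E)) (S : Set E) : unionLattice 𝒮 :=
  ⟨⋃₀ {K ∈ 𝒮 | K ⊆ S}, {K ∈ 𝒮 | K ⊆ S}, fun _ h => h.1, rfl⟩

/-- Deleting the elements of `I` from `S` one at a time gives a strictly decreasing chain of unions:
removing `d` loses the set chosen for `d`, while the sets chosen for the other elements avoid `d`
and survive. -/
theorem card_le_height_unionBelow (𝒮 : Set (Set E)) (I : Finset E) :
    ∀ S : Set E, (∀ d ∈ I, ∃ K ∈ 𝒮, K ⊆ S ∧ K ∩ I = {d}) →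
      (I.card : ℕ∞) ≤ Order.height (unionBelow 𝒮 S) := by
  classical
  induction I using Finset.induction_on with
  | empty => simp
  | insert d I hd ih =>
    intro S h
    have hlt : unionBelow 𝒮 (S \ {d}) < unionBelow 𝒮 S := by
      obtain ⟨K, hK, hKS, hKI⟩ := h d (Finset.mem_insert_self _ _)
      refine lt_of_le_of_ne ?_ fun heq => ?_
      · exact Set.sUnion_subset_sUnion fun A hA => ⟨hA.1, hA.2.trans Set.sdiff_subset⟩
      · have hdK : d ∈ K := (hKI.symm.subset rfl).1
        have hmem : d ∈ (unionBelow 𝒮 (S \ {d})).1 := by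
          rw [heq]
          exact ⟨K, ⟨hK, hKS⟩, hdK⟩
        obtain ⟨A, hA, hdA⟩ := hmem
        exact (hA.2 hdA).2 rfl
    rw [Finset.card_insert_of_notMem hd, Nat.cast_add, Nat.cast_one]
    refine le_trans ?_ (Order.height_add_one_le hlt)
    gcongr
    refine ih _ fun c hc => ?_
    obtain ⟨K, hK, hKS, hKI⟩ := h c (Finset.mem_insert_of_mem hc)
    have hcd : d ≠ c := by rintro rfl; exact hd hc
    refine ⟨K, hK, fun x hx => ⟨hKS hx, ?_⟩, ?_⟩
    · rintro rfl
      exact hcd (hKI.subset ⟨hx, by simp⟩)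
    · ext x
      constructor
      · rintro ⟨hxK, hxI⟩
        exact hKI.subset ⟨hxK, by simp [Finset.mem_coe.1 hxI]⟩
      · rintro rfl
        exact ⟨(hKI.symm.subset rfl).1, hc⟩

theorem card_le_height (𝒮 : Set (Set E)) (I : Finset E) (A : unionLattice 𝒮)
    (h : ∀ d ∈ I, ∃ K ∈ 𝒮, K ⊆ A.1 ∧ K ∩ I = {d}) : (I.card : ℕ∞) ≤ Order.height A :=
  (card_le_height_unionBelow 𝒮 I A.1 h).trans <|
    Order.height_mono (Set.sUnion_subset fun _ hK => hK.2)

end Height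

/-! ### Hypersums with few nonzero terms, and their images -/

section Sums

variable {G : Type*} [CommHypergroup G]

instance : Membership G (Subsets G) := inferInstanceAs (Membership G (Set G))

theorem mem_hyperSum_iff {ι : Type*} [Fintype ι] {x : ι → G} {y : G} :
    y ∈ hyperSum x ↔ y ∈ ∑ i, single (x i) := Iff.rfl

theorem single_zero : single (0 : G) = 0 := rfl

theorem mem_single_add_iff {x y : G} {S : Subsets G} :
    x ∈ single y + S ↔ ∃ s ∈ S, x ∈ CommHypergroup.hadd y s := by
  refine (mem_setAdd (A := ({y} : Set G)) (B := S)).trans ?_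
  simp only [Set.mem_singleton_iff, exists_eq_left]
  exact Iff.rfl

theorem zero_mem_single_add_iff {y : G} {S : Subsets G} :
    0 ∈ single y + S ↔ -y ∈ S := by
  rw [mem_single_add_iff]
  constructor
  · rintro ⟨s, hs, h⟩
    rwa [← CommHypergroup.eq_neg_of_zero_mem _ _ h]
  · exact fun h => ⟨-y, h, CommHypergroup.zero_mem_hadd_neg y⟩

theorem hyperneg_hyperneg (x : G) : -(-x) = x := by
  refine (CommHypergroup.eq_neg_of_zero_mem _ _ ?_).symm
  rw [CommHypergroup.hadd_comm]
  exact CommHypergroup.zero_mem_hadd_neg x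

/-- The image of subsets under a map preserving `0` and the hyperaddition. -/
def mapSubsets (φ : G → G) (h0 : φ 0 = 0)
    (hadd : ∀ x y, φ '' CommHypergroup.hadd x y = CommHypergroup.hadd (φ x) (φ y)) :
    Subsets G →+ Subsets G where
  toFun S := (φ '' (S : Set G) : Set G)
  map_zero' := by
    change φ '' {0} = {0}
    simp [h0]
  map_add' A B := by
    change φ '' setAdd (G := G) A B = setAdd (G := G) (φ '' A) (φ '' B)
    have key : ∀ A B : Set G, φ '' setAdd A B = setAdd (φ '' A) (φ '' B) := fun A B => by
      simp only [setAdd, Set.image_iUnion, hadd, Set.biUnion_image]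
    exact key A B

theorem mapSubsets_single (φ : G → G) (h0 : φ 0 = 0)
    (hadd : ∀ x y, φ '' CommHypergroup.hadd x y = CommHypergroup.hadd (φ x) (φ y)) (x : G) :
    mapSubsets φ h0 hadd (single x) = single (φ x) :=
  Set.image_singleton

/-- Applied to the involution, this makes orthogonality symmetric. -/
theorem zero_mem_hyperSum_image {ι : Type*} [Fintype ι] (φ : G → G) (h0 : φ 0 = 0)
    (hadd : ∀ x y, φ '' CommHypergroup.hadd x y = CommHypergroup.hadd (φ x) (φ y))
    {x : ι → G} (h : (0 : G) ∈ hyperSum x) : (0 : G) ∈ hyperSum fun i => φ (x i) := by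
  have key : (hyperSum fun i => φ (x i)) = φ '' hyperSum x := by
    have := map_sum (mapSubsets φ h0 hadd) (fun i => single (x i)) Finset.univ
    simp only [mapSubsets_single] at this
    exact this.symm
  rw [key]
  exact ⟨0, h, h0⟩

theorem sum_single_eq_of_cons {ι : Type*} [Fintype ι] {k : ℕ} {a b : ι} {e : Fin k → ι}
    (hab : a ≠ b) (ha : ∀ i, e i ≠ a) (hb : ∀ i, e i ≠ b) (he : Function.Injective e)
    {x : ι → G} (hx : ∀ c, c ≠ a → c ≠ b → (∀ i, e i ≠ c) → x c = 0) :
    ∑ c, single (x c) = single (x a) + (single (x b) + ∑ i, single (x (e i))) := by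
  let p : Fin (k + 2) → ι := Fin.cons a (Fin.cons b e : Fin (k + 1) → ι)
  have hinj : Function.Injective p := by
    rw [Fin.cons_injective_iff, Fin.cons_injective_iff]
    refine ⟨?_, by simpa using hb, he⟩
    rw [Fin.range_cons]
    simpa [hab] using ha
  have := Fintype.sum_of_injective p hinj (fun i => single (x (p i))) (fun c => single (x c))
    (fun c hc => ?_) (fun i => rfl)
  · rw [Fin.sum_univ_succ, Fin.sum_univ_succ] at this
    exact this.symm
  · rw [Fin.range_cons, Fin.range_cons] at hc
    simp only [Set.mem_insert_iff, Set.mem_range, not_or, not_exists] at hc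
    change single (x c) = 0
    rw [hx c hc.1 hc.2.1 hc.2.2, single_zero]

theorem zero_mem_hyperSum_pair {ι : Type*} [Fintype ι] {a b : ι} (hab : a ≠ b) {x : ι → G}
    (hx : ∀ c, c ≠ a → c ≠ b → x c = 0) : (0 : G) ∈ hyperSum x ↔ x b = -x a := by
  have h := sum_single_eq_of_cons (e := (Fin.elim0 : Fin 0 → ι)) hab (fun i => i.elim0)
    (fun i => i.elim0) (fun i => i.elim0) (x := x) (fun c h1 h2 _ => hx c h1 h2)
  rw [Finset.univ_eq_empty (α := Fin 0), Finset.sum_empty, add_zero] at h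
  rw [mem_hyperSum_iff, h, zero_mem_single_add_iff]
  exact eq_comm

theorem hyperSum_eq_of_eq_zero {ι : Type*} [Fintype ι] {a : ι} {x : ι → G}
    (hx : ∀ c, c ≠ a → x c = 0) : (hyperSum x : Set G) = {x a} :=
  Fintype.sum_eq_single (f := fun i => single (x i)) a fun c hc => by rw [hx c hc, single_zero]

end Sums

/-! ### Scaling, and symmetry of orthogonality -/

section Hyperfield

variable {F : Type*} [Hyperfield F]

theorem hyperneg_mul (x y : F) : -x * y = -(x * y) := by
  refine CommHypergroup.eq_neg_of_zero_mem _ _ ?_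
  rw [mul_comm x, mul_comm (-x), ← Hyperring.mul_hadd]
  exact ⟨0, CommHypergroup.zero_mem_hadd_neg x, mul_zero y⟩

/-- Multiplication of subsets by a scalar. -/
def scaleSubsets (a : F) : Subsets F →+ Subsets F :=
  mapSubsets (fun u => a * u) (mul_zero a) (Hyperring.mul_hadd a)

theorem scaleSubsets_single (a x : F) : scaleSubsets a (single x) = single (a * x) :=
  mapSubsets_single _ _ _ x

theorem mem_of_mul_mem_scaleSubsets {a x : F} (ha : a ≠ 0) {S : Subsets F}
    (h : a * x ∈ scaleSubsets a S) : x ∈ S := by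
  obtain ⟨y, hy, hyx⟩ := h
  rwa [← mul_left_cancel₀ ha hyx]

theorem Involution.apply_eq_zero_iff (τ : Involution F) {x : F} : τ.toFun x = 0 ↔ x = 0 :=
  map_eq_zero τ.toMonoidWithZeroHom

theorem Orthogonal.symm {E : Type*} [Fintype E] {τ : Involution F} {X Y : E → F}
    (h : Orthogonal τ X Y) : Orthogonal τ Y X := by
  have := zero_mem_hyperSum_image τ.toFun (τ.apply_eq_zero_iff.2 rfl) τ.map_hadd h
  have key : ∀ e, τ.toFun (X e * τ.toFun (Y e)) = Y e * τ.toFun (X e) := fun e => by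
    have : τ.toFun (X e * τ.toFun (Y e)) = τ.toFun (X e) * τ.toFun (τ.toFun (Y e)) :=
      map_mul τ.toMonoidWithZeroHom _ _
    rw [this, τ.involutive, mul_comm]
  simpa only [Orthogonal, key] using this

theorem smul_support {E : Type*} {a : F} (ha : a ≠ 0) (X : E → F) :
    Function.support (a • X) = Function.support X := by
  ext e
  simp [ha]

end Hyperfield

/-! ### Signatures, orthogonality and elimination -/

section Signature

variable {F : Type*} [Hyperfield F] {E : Type*} {M : Matroid E} {C D : Set (E → F)}

theorem IsSignature.isCircuit (hC : IsSignature M C) {X : E → F} (hX : X ∈ C) :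
    M.IsCircuit (Function.support X) :=
  hC.bijOn.mapsTo ⟨X, hX, rfl⟩

theorem IsSignature.exists_support_eq (hC : IsSignature M C) {S : Set E} (hS : M.IsCircuit S) :
    ∃ X ∈ C, Function.support X = S := by
  obtain ⟨_, ⟨X, hX, rfl⟩, h⟩ := hC.bijOn.surjOn hS
  exact ⟨X, hX, h⟩

theorem IsSignature.exists_smul_eq (hC : IsSignature M C) {X Y : E → F} (hX : X ∈ C) (hY : Y ∈ C)
    (h : Function.support X ⊆ Function.support Y) : ∃ a : F, a ≠ 0 ∧ X = a • Y :=
  Quotient.exact <| hC.bijOn.injOn ⟨X, hX, rfl⟩ ⟨Y, hY, rfl⟩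
    ((hC.isCircuit hX).eq_of_subset_isCircuit (hC.isCircuit hY) h)

theorem IsSignature.isCircuit_iff (hC : IsSignature M C) (S : Set E) :
    M.IsCircuit S ↔ S ∈ Function.support '' C :=
  ⟨hC.exists_support_eq, by rintro ⟨X, hX, rfl⟩; exact hC.isCircuit hX⟩

/-- In a set of height `k + 1` in the lattice of unions of circuits, any `k + 1` elements in the
closure of the remaining ones meet, together with any further element, the trace of a cocircuit
through that element. -/
theorem exists_isCocircuit_of_height_lt {𝒮 : Set (Set E)} (hM : M.E = Set.univ)
    (h𝒮 : ∀ S, M.IsCircuit S → S ∈ 𝒮) (A : unionLattice 𝒮) (B : Finset E) (hBA : ↑B ⊆ A.1)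
    (hB : ↑B ⊆ M.closure (A.1 \ B)) {f : E} (hfA : f ∈ A.1) (hfB : f ∉ B)
    (hht : Order.height A < B.card + 1) :
    ∃ K, M.IsCocircuit K ∧ f ∈ K ∧ K ∩ A.1 ⊆ insert f ↑B := by
  classical
  set S : Set E := A.1 \ insert f ↑B with hS
  have hSE : S ⊆ M.E := by simp [hM]
  by_cases hf : f ∈ M.closure S
  swap
  · obtain ⟨K, hK, hfK, hdisj⟩ := Matroid.exists_isCocircuit_disjoint hSE (by simp [hM]) hf
    refine ⟨K, hK, hfK, fun x hx => ?_⟩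
    by_contra hxB
    exact Set.disjoint_left.1 hdisj hx.1 ⟨hx.2, hxB⟩
  -- Otherwise `f`, and with it all of `B`, lies in the closure of `S`. Each `d` in `insert f B`
  -- then has a circuit inside `insert d S`, and these circuits force the height up to `B.card + 1`.
  refine absurd hht (not_lt.2 ?_)
  have hcl : ∀ d ∈ insert f B, d ∈ M.closure S := by
    intro d hd
    rcases Finset.mem_insert.1 hd with rfl | hd
    · exact hf
    · have hsub : A.1 \ ↑B ⊆ M.closure S := fun x hx => by
        by_cases hxf : x = f
        · exact hxf ▸ hf
        · exact M.mem_closure_of_mem (⟨hx.1, by simpa [hxf] using hx.2⟩ : x ∈ S) hSE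
      exact M.closure_subset_closure_of_subset_closure hsub (hB hd)
  have := card_le_height 𝒮 (insert f B) A fun d hd => by
    have hdS : d ∉ S := fun h => h.2 (by simpa using hd)
    obtain ⟨K, hKS, hK, hdK⟩ := Matroid.exists_isCircuit_of_mem_closure (hcl d hd) hdS
    have hdA : d ∈ A.1 := by
      rcases Finset.mem_insert.1 hd with rfl | hd
      exacts [hfA, hBA hd]
    refine ⟨K, h𝒮 K hK, fun x hx => ?_, ?_⟩
    · rcases hKS hx with rfl | h
      exacts [hdA, h.1]
    · ext x
      constructor
      · rintro ⟨hxK, hxB⟩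
        exact (hKS hxK).resolve_right fun h => h.2 (by simpa using hxB)
      · rintro rfl
        exact ⟨hdK, hd⟩
  rwa [Finset.card_insert_of_notMem hfB, Nat.cast_add, Nat.cast_one] at this

variable [Fintype E] {τ : Involution F}

theorem Orthogonal.support_inter_ne_singleton {X Y : E → F} (h : Orthogonal τ X Y) (e : E) :
    Function.support X ∩ Function.support Y ≠ {e} := by
  intro he
  have hsupp : ∀ c, c ≠ e → X c * τ.toFun (Y c) = 0 := fun c hc => by
    by_contra hne
    rw [mul_eq_zero, τ.apply_eq_zero_iff, not_or] at hne
    exact hc (he.subset hne)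
  unfold Orthogonal at h
  rw [hyperSum_eq_of_eq_zero (x := fun e => X e * τ.toFun (Y e)) hsupp] at h
  have hmem := he.symm.subset rfl
  have : X e * τ.toFun (Y e) = 0 := h.symm
  rw [mul_eq_zero, τ.apply_eq_zero_iff] at this
  exact this.elim hmem.1 hmem.2

theorem orthogonal_iff_of_pair {X Y : E → F} {a b : E} (hab : a ≠ b)
    (h : ∀ c, c ≠ a → c ≠ b → X c = 0 ∨ Y c = 0) :
    Orthogonal τ X Y ↔ X b * τ.toFun (Y b) = -(X a * τ.toFun (Y a)) :=
  zero_mem_hyperSum_pair hab fun c hca hcb => by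
    rw [mul_eq_zero, τ.apply_eq_zero_iff]
    exact h c hca hcb

theorem exists_smul_eq_of_orthogonal (hC : IsSignature M C) {W Y : E → F}
    (hW : ∀ X ∈ C, Orthogonal τ W X) (hY : ∀ X ∈ C, Orthogonal τ Y X)
    (hcirc : M.IsCocircuit (Function.support Y))
    (hsupp : Function.support W = Function.support Y) : ∃ a : F, a ≠ 0 ∧ W = a • Y := by
  obtain ⟨e, he⟩ := hcirc.nonempty
  have heW : W e ≠ 0 := hsupp.symm.subset he
  have heY : Y e ≠ 0 := he
  refine ⟨W e * (Y e)⁻¹, mul_ne_zero heW (inv_ne_zero heY), funext fun f => ?_⟩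
  rw [Pi.smul_apply, smul_eq_mul]
  by_cases hf : f ∈ Function.support Y
  swap
  · have hf' : f ∉ Function.support W := hsupp ▸ hf
    rw [Function.notMem_support.1 hf, Function.notMem_support.1 hf', mul_zero]
  by_cases hef : e = f
  · subst hef
    rw [mul_assoc, inv_mul_cancel₀ heY, mul_one]
  obtain ⟨A, hA, hAY⟩ := hcirc.exists_isCircuit_inter_eq_pair he hf hef
  obtain ⟨X, hX, rfl⟩ := hC.exists_support_eq hA
  have hpair : ∀ c, c ≠ e → c ≠ f → Y c = 0 ∨ X c = 0 := fun c hce hcf => by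
    by_contra! h
    have := hAY.subset ⟨h.2, h.1⟩
    exact this.elim hce hcf
  have hpair' : ∀ c, c ≠ e → c ≠ f → W c = 0 ∨ X c = 0 := fun c hce hcf =>
    (hpair c hce hcf).imp_left fun h => by
      have : c ∉ Function.support W := hsupp ▸ Function.notMem_support.2 h
      exact Function.notMem_support.1 this
  have h1 := (orthogonal_iff_of_pair hef hpair').1 (hW X hX)
  have h2 := (orthogonal_iff_of_pair hef hpair).1 (hY X hX)
  have hXf : τ.toFun (X f) ≠ 0 := fun h =>
    (hAY.symm.subset (Or.inr rfl)).1 (τ.apply_eq_zero_iff.1 h)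
  -- Both orthogonality relations with `X` have only the terms at `e` and `f`, so `W f / W e = Y f /
  -- Y e`.
  refine mul_right_cancel₀ hXf ?_
  rw [h1, mul_assoc, h2, mul_comm _ (-(_)), hyperneg_mul]
  congr 1
  field_simp

theorem suppMin_perp_eq (hM : M.E = Set.univ) (hC : IsSignature M C) (hD : IsSignature M.dual D)
    (h : ∀ X ∈ C, ∀ Y ∈ D, Orthogonal τ X Y) : suppMin (perp τ C \ {0}) = D := by
  have hsub : ∀ Y ∈ D, Y ∈ perp τ C \ {0} := fun Y hY =>
    ⟨fun X hX => (h X hX Y hY).symm, fun h0 => hD.zero_notMem ((h0 : Y = 0) ▸ hY)⟩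
  have hcont : ∀ W ∈ perp τ C \ {0}, ∃ Y ∈ D, Function.support Y ⊆ Function.support W := by
    rintro W ⟨hW, hW0⟩
    obtain ⟨K, hKW, hK⟩ := M.exists_isCocircuit_subset (Function.support_nonempty_iff.2 hW0)
      (by simp [hM]) (fun A hA e => by
        obtain ⟨X, hX, rfl⟩ := hC.exists_support_eq hA
        exact (hW X hX).symm.support_inter_ne_singleton e)
    obtain ⟨Y, hY, rfl⟩ := hD.exists_support_eq hK
    exact ⟨Y, hY, hKW⟩
  ext W
  constructor
  · rintro ⟨hW, hmin⟩
    obtain ⟨Y, hY, hYW⟩ := hcont W hW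
    obtain ⟨a, ha, rfl⟩ := exists_smul_eq_of_orthogonal hC hW.1 (hsub Y hY).1 (hD.isCircuit hY)
      (hmin Y (hsub Y hY) hYW).symm
    exact hD.smul_mem Y hY a ha
  · refine fun hW => ⟨hsub W hW, fun V hV hVW => ?_⟩
    obtain ⟨Y, hY, hYV⟩ := hcont V hV
    exact hVW.antisymm <| ((hD.isCircuit hY).eq_of_subset_isCircuit (hD.isCircuit hW)
      (hYV.trans hVW)).symm.subset.trans hYV

theorem strongModularElimination_of_orthogonal (hM : M.E = Set.univ) (hC : IsSignature M C)
    (hD : IsSignature M.dual D) (h : ∀ X ∈ C, ∀ Y ∈ D, Orthogonal τ X Y) :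
    StrongModularElimination C := by
  classical
  intro k X Y e hX hY hmod hnot he hXe
  obtain ⟨f₀, hf₀X, hf₀⟩ := Set.not_subset.1 hnot
  have hf₀Y : ∀ i, Y i f₀ = 0 := fun i => by
    by_contra hne
    exact hf₀ (Set.mem_iUnion.2 ⟨i, hne⟩)
  have heY : ∀ i, Y i (e i) ≠ 0 := fun i => (he i).1.2
  have heY' : ∀ i j, j ≠ i → Y j (e i) = 0 := fun i j hji => by
    by_contra hne
    exact (he i).2 (Set.mem_iUnion₂.2 ⟨j, hji, hne⟩)
  have heinj : Function.Injective e := fun i j hij => by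
    by_contra hne
    exact heY i (hij ▸ heY' j i hne)
  have hef₀ : ∀ i, e i ≠ f₀ := fun i hi => heY i (hi ▸ hf₀Y i)
  obtain ⟨-, hmem, hht⟩ := hmod
  set A : Set E := ⋃ i, (Fin.cons (Function.support X) fun i => Function.support (Y i) :
    Fin (k + 1) → Set E) i with hA
  have hXA : Function.support X ⊆ A := Set.subset_iUnion_of_subset 0 (by simp)
  have hYA : ∀ i, Function.support (Y i) ⊆ A := fun i =>
    Set.subset_iUnion_of_subset i.succ (by simp)
  set B : Finset E := insert f₀ (Finset.univ.image e) with hB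
  have hmemB : ∀ c, c ∈ B ↔ c = f₀ ∨ ∃ i, e i = c := by simp [hB]
  have hBcard : B.card = k + 1 := by
    rw [hB, Finset.card_insert_of_notMem (by simpa using hef₀),
      Finset.card_image_of_injective _ heinj, Finset.card_univ, Fintype.card_fin]
  have hBA : ↑B ⊆ A := fun c hc => by
    rcases (hmemB c).1 hc with rfl | ⟨i, rfl⟩
    exacts [hXA hf₀X, hYA i (heY i)]
  have hsubE : ∀ S : Set E, S ⊆ M.E := fun S => by simp [hM]
  have hecl : ∀ i, e i ∈ M.closure (A \ B) := fun i => by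
    refine M.closure_subset_closure ?_
      ((hC.isCircuit (hY i)).mem_closure_sdiff_singleton_of_mem (heY i))
    rintro c ⟨hc, hce⟩
    refine ⟨hYA i hc, fun hcB => ?_⟩
    rcases (hmemB c).1 hcB with rfl | ⟨j, rfl⟩
    · exact hc (hf₀Y i)
    · exact hc (heY' j i (by rintro rfl; exact hce rfl))
  -- The rest of the support of `X` may contain some `e i`, but these are already spanned by `A \ B`
  -- through the `Y i`.
  have hf₀cl : f₀ ∈ M.closure (A \ B) := by
    refine M.closure_subset_closure_of_subset_closure (fun c hc => ?_)
      ((hC.isCircuit hX).mem_closure_sdiff_singleton_of_mem hf₀X)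
    by_cases hcB : c ∈ B
    · obtain ⟨i, rfl⟩ := ((hmemB c).1 hcB).resolve_left hc.2
      exact hecl i
    · exact M.mem_closure_of_mem ⟨hXA hc.1, hcB⟩ (hsubE _)
  have hBcl : ↑B ⊆ M.closure (A \ B) := fun c hc => by
    rcases (hmemB c).1 hc with rfl | ⟨i, rfl⟩
    exacts [hf₀cl, hecl i]
  obtain ⟨K, hK, hKc, hf₀K⟩ := Matroid.exists_isCircuit_of_mem_closure hf₀cl
    (fun hh => hh.2 ((hmemB _).2 (Or.inl rfl)))
  obtain ⟨Z', hZ', rfl⟩ := hC.exists_support_eq hKc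
  obtain ⟨Z, hZ, hZf₀, hsupp⟩ : ∃ Z ∈ C, Z f₀ = X f₀ ∧
      Function.support Z = Function.support Z' := by
    have ha : X f₀ * (Z' f₀)⁻¹ ≠ 0 := mul_ne_zero hf₀X (inv_ne_zero hf₀K)
    refine ⟨_, hC.smul_mem Z' hZ' _ ha, ?_, smul_support ha Z'⟩
    rw [Pi.smul_apply, smul_eq_mul, mul_assoc, inv_mul_cancel₀ hf₀K, mul_one]
  have hZK : Function.support Z ⊆ insert f₀ (A \ B) := hsupp ▸ hK
  have hZe : ∀ i, Z (e i) = 0 := fun i => by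
    by_contra hne
    rcases hZK hne with hh | hh
    · exact hef₀ i hh
    · exact hh.2 ((hmemB _).2 (Or.inr ⟨i, rfl⟩))
  refine ⟨Z, hZ, hZe, fun f => ?_⟩
  change Z f ∈ single (X f) + ∑ i, single (Y i f)
  by_cases hff₀ : f = f₀
  · subst hff₀
    simp only [hf₀Y, single_zero, Finset.sum_const_zero, add_zero]
    exact hZf₀
  by_cases hfe : ∃ i, e i = f
  · obtain ⟨i, rfl⟩ := hfe
    rw [hZe, Fintype.sum_eq_single (f := fun j => single (Y j (e i))) i fun j hj => by
      rw [heY' i j hj, single_zero]]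
    rw [zero_mem_single_add_iff, (hXe i).1, hyperneg_hyperneg]
    rfl
  by_cases hfA : f ∈ A
  swap
  · have hzero : ∀ V : E → F, Function.support V ⊆ A → V f = 0 := fun V hV => by
      by_contra hne
      exact hfA (hV hne)
    have hYf : ∀ i, Y i f = 0 := fun i => hzero _ (hYA i)
    have hZf : Z f = 0 := hzero Z fun c hc => by
      rcases hZK hc with rfl | hh
      exacts [hXA hf₀X, hh.1]
    simp only [hYf, hZf, hzero X hXA, single_zero, Finset.sum_const_zero, add_zero]
    rfl
  have hfB : f ∉ B := fun hh => ((hmemB f).1 hh).elim hff₀ hfe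
  -- Modularity enters here: the height of `A` is `k + 1 = B.card`, one too small for `B ∪ {f}` to
  -- be spanned by the rest of `A`.
  obtain ⟨L, hL, hfL, hLA⟩ := exists_isCocircuit_of_height_lt hM
    (fun S hS => (hC.isCircuit_iff S).1 hS) ⟨A, hmem⟩ B hBA hBcl hfA hfB (by
      rw [hht, hBcard]
      exact_mod_cast Nat.lt_succ_self _)
  obtain ⟨V, hV, rfl⟩ := hD.exists_support_eq hL
  have hVz : ∀ c ∈ A, c ≠ f₀ → c ≠ f → (∀ i, e i ≠ c) → V c = 0 := fun c hcA h1 h2 h3 => by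
    by_contra hne
    rcases hLA ⟨hne, hcA⟩ with hc | hc
    · exact h2 hc
    · rcases (hmemB c).1 hc with hc | ⟨i, hc⟩
      exacts [h1 hc, h3 i hc]
  have hef : ∀ i, e i ≠ f := fun i hi => hfe ⟨i, hi⟩
  have hVf : τ.toFun (V f) ≠ 0 := fun hh => hfL (τ.apply_eq_zero_iff.1 hh)
  -- Inside `A`, the supports of `Y i` and `V` can share only `e i` and `f`; the sign from
  -- orthogonality cancels the one in `X (e i) = -(Y i (e i))`.
  have hYV : ∀ i, Y i f * τ.toFun (V f) = X (e i) * τ.toFun (V (e i)) := fun i => by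
    rw [(hXe i).1, hyperneg_mul]
    refine (orthogonal_iff_of_pair (hef i) fun c h1 h2 => ?_).1 (h _ (hY i) V hV)
    by_contra! hc
    refine hc.2 (hVz c (hYA i hc.1) (fun h3 => hc.1 (h3 ▸ hf₀Y i)) h2 fun j hj => hc.1 ?_)
    rw [← hj]
    exact heY' j i (fun hij => h1 (hij ▸ hj.symm))
  have hZV : Z f * τ.toFun (V f) = -(X f₀ * τ.toFun (V f₀)) := by
    rw [← hZf₀]
    refine (orthogonal_iff_of_pair (Ne.symm hff₀) fun c h1 h2 => ?_).1 (h Z hZ V hV)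
    by_contra! hc
    have hcAB := (hZK hc.1).resolve_left h1
    exact hc.2 (hVz c hcAB.1 h1 h2 fun i hi => hcAB.2 ((hmemB c).2 (Or.inr ⟨i, hi⟩)))
  -- Isolating the term at `f₀` in `X ⊥ V` and replacing its negative by `Z f * τ (V f)` leaves the
  -- desired membership multiplied by `τ (V f)`.
  have hXV := h X hX V hV
  rw [Orthogonal, mem_hyperSum_iff, sum_single_eq_of_cons (Ne.symm hff₀) hef₀ hef heinj
    (x := fun c => X c * τ.toFun (V c)) (fun c h1 h2 h3 => by
      rw [mul_eq_zero, τ.apply_eq_zero_iff]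
      by_contra! hc
      exact hc.2 (hVz c (hXA hc.1) h1 h2 h3)), zero_mem_single_add_iff, ← hZV] at hXV
  simp only [← hYV] at hXV
  refine mem_of_mul_mem_scaleSubsets hVf ?_
  simp only [map_add, map_sum, scaleSubsets_single]
  simpa only [mul_comm (τ.toFun (V f))] using hXV

end Signature

end HyperMatroid

theorem theorem3p22 {F : Type*} [Hyperfield F] (τ : HyperMatroid.Involution F)
    {E : Type*} [Fintype E] (M : Matroid E) (hM : M.E = Set.univ)
    (C D : Set (E → F))
    (hC : HyperMatroid.IsSignature M C) (hD : HyperMatroid.IsSignature M.dual D) :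
    (∃ N : HyperMatroid.StrongFMatroid F E,
        N.IsUnderlying M ∧ N.circuits = C ∧ N.cocircuits τ = D) ↔
      ∀ X ∈ C, ∀ Y ∈ D, HyperMatroid.Orthogonal τ X Y := by
  constructor
  · rintro ⟨N, -, rfl, rfl⟩ X hX Y hY
    exact (hY.1.1 X hX).symm
  · intro h
    exact ⟨⟨C, hC.zero_notMem, hC.smul_mem, fun X hX Y hY => hC.exists_smul_eq hX hY,
      HyperMatroid.strongModularElimination_of_orthogonal hM hC hD h⟩,
      ⟨hM, hC.isCircuit_iff⟩, rfl, HyperMatroid.suppMin_perp_eq hM hC hD h⟩
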